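/- \textbf{Theorem (Minimization and Uniqueness).} Let $X$ be a random vector in $\mathbb{R}^n$ and let $X'$ be an independent copy of $X$. A \emph{rotational symmetrization} of $X$ is a random vector $X_{rot}$ in $\mathbb{R}^n$ such that $\|X_{rot}\|$ has the same distribution as $\|X\|$ and $QX_{rot}$ has the same distribution as $X_{rot}$ for every $Q\in O(n)$. Let $X_{rot}, X_{rot}'$ be independent copies of the rotational symmetrization of $X$. (a) (Minimization) For every positive integer $k$ with $\mathbb{E}\|X\|^k<\infty$, both expectations below exist and $$\mathbb{E}\big(\langle X,X'\rangle^k\big)\ \ge\ \mathbb{E}\big(\langle X_{rot},X_{rot}'\rangle^k\big).$$ (b) (Uniqueness) Suppose that $X$ is subexponential, i.e. for every $v\in\mathbb{R}^n$ there is $K>0$ with $\mathbb{P}(|\langle X,v\rangle|>t)\le \exp(1-t/K)$ for all $t\ge 0$. If equality holds in (a) for all positive integers $k$, then $X$ is rotationally invariant, i.e. $QX$ has the same distribution as $X$ for every $Q\in O(n)$. (c) (Orthogonality) For every positive integer $k$ with $\mathbb{E}\|X\|^k<\infty$, the moment tensors $M^k_X=\mathbb{E}(X^{\otimes k})$ and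 $M^k_{X_{rot}}=\mathbb{E}(X_{rot}^{\otimes k})$ exist, and the $k$-th eccentricity tensor $E^k_X=M^k_X-M^k_{X_{rot}}$ satisfies $$\langle E^k_X, M^k_{X_{rot}}\rangle=0,\qquad \|M^k_X\|^2=\|M^k_{X_{rot}}\|^2+\|E^k_X\|^2,$$ where $(\mathbb{R}^n)^{\otimes k}$ is identified with Euclidean $\mathbb{R}^{n^k}$ through the basis $e_{i_1}\otimes\cdots\otimes e_{i_k}$. -/

import Mathlib

open MeasureTheory ProbabilityTheory
open scoped RealInnerProductSpace

/-- The power tensor `x^{⊗k}` of a vector `x ∈ ℝⁿ`. The `k`-th tensor power of `ℝⁿ` is identified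
with the Euclidean space of `n^k` coordinates given by the basis `e_{i₁} ⊗ ⋯ ⊗ e_{i_k}`. -/
noncomputable def tensorPow {n : ℕ} (k : ℕ) (x : EuclideanSpace ℝ (Fin n)) :
    EuclideanSpace ℝ (Fin k → Fin n) :=
  WithLp.toLp 2 (fun i => ∏ j, x (i j))

/-- The `k`-th moment tensor `M^k_X = E[X^{⊗k}]` of a random vector `X` on `(Ω, P)`. -/
noncomputable def momentTensor {n : ℕ} {Ω : Type*} [MeasurableSpace Ω] (k : ℕ)
    (X : Ω → EuclideanSpace ℝ (Fin n)) (P : Measure Ω) : EuclideanSpace ℝ (Fin k → Fin n) :=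
  ∫ ω, tensorPow k (X ω) ∂P

/-- The distribution of `X` is rotationally invariant: `Q X` and `X` have the same distribution for
every `Q ∈ O(n)`, the group of linear isometries of `ℝⁿ`. -/
def IsRotationallyInvariant {n : ℕ} {Ω : Type*} [MeasurableSpace Ω]
    (X : Ω → EuclideanSpace ℝ (Fin n)) (P : Measure Ω) : Prop :=
  ∀ Q : EuclideanSpace ℝ (Fin n) ≃ₗᵢ[ℝ] EuclideanSpace ℝ (Fin n),
    IdentDistrib (fun ω => Q (X ω)) X P P

/-- The random vector `Y` on `(Ω', P')` is (a version of) the rotational symmetrization `X_rot` of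
the random vector `X` on `(Ω, P)`: it has the same radial distribution as `X` and its
distribution is rotationally invariant. -/
structure IsRotationalSymmetrization {n : ℕ} {Ω Ω' : Type*} [MeasurableSpace Ω]
    [MeasurableSpace Ω'] (Y : Ω' → EuclideanSpace ℝ (Fin n)) (P' : Measure Ω')
    (X : Ω → EuclideanSpace ℝ (Fin n)) (P : Measure Ω) : Prop where
  radial : IdentDistrib (fun ω => ‖Y ω‖) (fun ω => ‖X ω‖) P' P
  invariant : IsRotationallyInvariant Y P'

/-- The `k`-th eccentricity tensor `E^k_X = M^k_X - M^k_{X_rot}`, where `Y` on `(Ω', P')` is a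
version of the rotational symmetrization `X_rot` of `X`. -/
noncomputable def eccentricityTensor {n : ℕ} {Ω Ω' : Type*} [MeasurableSpace Ω]
    [MeasurableSpace Ω'] (k : ℕ) (X : Ω → EuclideanSpace ℝ (Fin n)) (P : Measure Ω)
    (Y : Ω' → EuclideanSpace ℝ (Fin n)) (P' : Measure Ω') : EuclideanSpace ℝ (Fin k → Fin n) :=
  momentTensor k X P - momentTensor k Y P'

/-- `X` has finite `k`-th moment: `E ‖X‖^k < ∞`. -/
def HasFiniteMoment {n : ℕ} {Ω : Type*} [MeasurableSpace Ω] (k : ℕ)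
    (X : Ω → EuclideanSpace ℝ (Fin n)) (P : Measure Ω) : Prop :=
  Integrable (fun ω => ‖X ω‖ ^ k) P

/-- A real random variable `Z` is subexponential if it has exponential tail decay: there is some
`K > 0` such that `P (|Z| > t) ≤ exp (1 - t / K)` for all `t ≥ 0`. -/
def IsSubexponential {Ω : Type*} [MeasurableSpace Ω] (Z : Ω → ℝ) (P : Measure Ω) : Prop :=
  ∃ K : ℝ, 0 < K ∧ ∀ t : ℝ, 0 ≤ t → P.real {ω | t < |Z ω|} ≤ Real.exp (1 - t / K)

/-- A random vector is subexponential if all its one-dimensional marginals are. -/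
def IsSubexponentialVector {n : ℕ} {Ω : Type*} [MeasurableSpace Ω]
    (X : Ω → EuclideanSpace ℝ (Fin n)) (P : Measure Ω) : Prop :=
  ∀ v : EuclideanSpace ℝ (Fin n), IsSubexponential (fun ω => ⟪X ω, v⟫) P

/-- Every random vector in `ℝⁿ` has a rotational symmetrization. -/
theorem exists_isRotationalSymmetrization {n : ℕ} {Ω : Type*} [MeasurableSpace Ω]
    {P : Measure Ω} [IsProbabilityMeasure P] {X : Ω → EuclideanSpace ℝ (Fin n)}
    (hX : AEMeasurable X P) :
    ∃ Y : Ω × EuclideanSpace ℝ (Fin n) → EuclideanSpace ℝ (Fin n),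
      IsRotationalSymmetrization Y (P.prod (stdGaussian (EuclideanSpace ℝ (Fin n)))) X P := by
  set γ := stdGaussian (EuclideanSpace ℝ (Fin n)) with hγ
  have hr : AEMeasurable (fun z : Ω × EuclideanSpace ℝ (Fin n) => ‖X z.1‖) (P.prod γ) :=
    (hX.comp_quasiMeasurePreserving Measure.quasiMeasurePreserving_fst).norm
  have hY : AEMeasurable (fun z : Ω × EuclideanSpace ℝ (Fin n) => (‖X z.1‖ / ‖z.2‖) • z.2)
      (P.prod γ) :=
    (hr.div measurable_snd.norm.aemeasurable).smul measurable_snd.aemeasurable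
  refine ⟨fun z => (‖X z.1‖ / ‖z.2‖) • z.2, ?_, ?_⟩
  · have hnorm : (fun z : Ω × EuclideanSpace ℝ (Fin n) => ‖(‖X z.1‖ / ‖z.2‖) • z.2‖)
        =ᵐ[P.prod γ] fun z => ‖X z.1‖ := by
      rcases Nat.eq_zero_or_pos n with rfl | hn
      · exact Filter.Eventually.of_forall fun z => by simp [Subsingleton.elim (X z.1) 0,
          Subsingleton.elim z.2 0]
      have h0 : ∀ᵐ g ∂γ, g ≠ 0 := by
        have hm : γ.map (fun g : EuclideanSpace ℝ (Fin n) => g ⟨0, hn⟩) = gaussianReal 0 1 := by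
          rw [hγ, ← map_pi_eq_stdGaussian, Measure.map_map (by fun_prop) (by fun_prop)]
          exact (measurePreserving_eval (fun _ : Fin n => gaussianReal 0 1) ⟨0, hn⟩).map_eq
        have h1 : ∀ᵐ y ∂(γ.map (fun g : EuclideanSpace ℝ (Fin n) => g ⟨0, hn⟩)), y ≠ 0 := by
          rw [hm]
          have := nullSingletonClass_gaussianReal (μ := 0) (v := 1) one_ne_zero
          simp [ae_iff]
        filter_upwards [ae_of_ae_map (by fun_prop) h1] with g hg h
        exact hg (by simp [h])
      filter_upwards [Measure.quasiMeasurePreserving_snd.ae h0] with z hz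
      rw [norm_smul, norm_div, norm_norm, norm_norm, div_mul_cancel₀ _ (norm_ne_zero_iff.2 hz)]
    refine ⟨hY.norm, hX.norm, ?_⟩
    rw [Measure.map_congr hnorm]
    have h := AEMeasurable.map_map_of_aemeasurable (μ := P.prod γ) (f := Prod.fst)
      (g := fun ω => ‖X ω‖) (by simpa using hX.norm) measurable_fst.aemeasurable
    simp only [Measure.map_fst_prod, measure_univ, one_smul] at h
    exact h.symm
  · intro Q
    have hQ : MeasurePreserving (Prod.map id Q) (P.prod γ) (P.prod γ) :=
      (MeasurePreserving.id P).prod ⟨Q.continuous.measurable, stdGaussian_map Q⟩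
    refine ⟨Q.continuous.measurable.comp_aemeasurable hY, hY, ?_⟩
    conv_rhs => rw [← hQ.map_eq]
    rw [AEMeasurable.map_map_of_aemeasurable (by rwa [hQ.map_eq]) hQ.measurable.aemeasurable]
    congr 1
    funext z
    simp

/-! Power tensors satisfy ⟨x^{⊗k}, y^{⊗k}⟩ = ⟨x, y⟩^k, so by independence E⟨X, X'⟩^k = ‖M^k_X‖²
(`integral_inner_pow_eq_norm_momentTensor_sq`). If Y is rotationally invariant, E⟨x, Y⟩^k = c‖x‖^k,
hence ⟨M^k_X, M^k_Y⟩ = c E‖X‖^k sees X only through its norm. For Y = X_rot this number is unchanged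
when X is replaced by X_rot, which says that E^k_X is orthogonal to M^k_{X_rot}. Pythagoras then
gives (c), and (a) follows.

Equality for all k forces every E^k_X to vanish. For subexponential X the norm has an exponential
moment, so the complex moment-generating function of each marginal is analytic on a strip around the
imaginary axis and is determined by the moments. Its value at i is the characteristic function, so X
and X_rot have the same law. -/

lemma inner_tensorPow {n : ℕ} (k : ℕ) (x y : EuclideanSpace ℝ (Fin n)) :
    ⟪tensorPow k x, tensorPow k y⟫ = ⟪x, y⟫ ^ k := by
  simp only [tensorPow, PiLp.inner_apply, RCLike.inner_apply, conj_trivial]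
  simp_rw [← Finset.prod_mul_distrib, ← Fin.prod_const k (∑ i, y i * x i),
    Finset.prod_univ_sum, Fintype.piFinset_univ]

lemma norm_tensorPow {n : ℕ} (k : ℕ) (x : EuclideanSpace ℝ (Fin n)) :
    ‖tensorPow k x‖ = ‖x‖ ^ k := by
  have h : ‖tensorPow k x‖ ^ 2 = (‖x‖ ^ k) ^ 2 := by
    rw [← real_inner_self_eq_norm_sq, inner_tensorPow, real_inner_self_eq_norm_sq]
    ring
  exact (pow_left_inj₀ (norm_nonneg _) (by positivity) two_ne_zero).1 h

lemma continuous_tensorPow {n : ℕ} (k : ℕ) : Continuous (tensorPow (n := n) k) := by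
  unfold tensorPow
  fun_prop

/-! ### Moment tensors and orthogonality of the eccentricity -/

section Moments

variable {n : ℕ} {Ω Ω' : Type*} [MeasurableSpace Ω] [MeasurableSpace Ω']
  {P : Measure Ω} {P' : Measure Ω'}
  {X X' : Ω → EuclideanSpace ℝ (Fin n)} {Y : Ω' → EuclideanSpace ℝ (Fin n)} {k : ℕ}

lemma HasFiniteMoment.integrable_tensorPow (hX : AEMeasurable X P) (h : HasFiniteMoment k X P) :
    Integrable (fun ω => tensorPow k (X ω)) P :=
  Integrable.mono' h
    ((continuous_tensorPow k).comp_aestronglyMeasurable hX.aestronglyMeasurable)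
    (Filter.Eventually.of_forall fun _ => (norm_tensorPow k _).le)

lemma ProbabilityTheory.IdentDistrib.tensorPow_comp {Z : Ω' → EuclideanSpace ℝ (Fin n)}
    (h : IdentDistrib X Z P P') (k : ℕ) :
    IdentDistrib (fun ω => tensorPow k (X ω)) (fun ω => tensorPow k (Z ω)) P P' :=
  h.comp (continuous_tensorPow k).measurable

lemma inner_momentTensor (hX : Integrable (fun ω => tensorPow k (X ω)) P)
    (v : EuclideanSpace ℝ (Fin n)) :
    ⟪tensorPow k v, momentTensor k X P⟫ = ∫ ω, ⟪v, X ω⟫ ^ k ∂P := by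
  simp_rw [momentTensor, ← integral_inner hX, inner_tensorPow]

/-- The `k`-th moment of `⟪X, X'⟫` for independent copies `X`, `X'` is the squared norm of the
moment tensor. -/
lemma integral_inner_pow_eq_norm_momentTensor_sq
    (hX : Integrable (fun ω => tensorPow k (X ω)) P) (hcopy : IdentDistrib X' X P P)
    (hindep : IndepFun X X' P) :
    Integrable (fun ω => ⟪X ω, X' ω⟫ ^ k) P ∧
      ∫ ω, ⟪X ω, X' ω⟫ ^ k ∂P = ‖momentTensor k X P‖ ^ 2 := by
  have hX' := (hcopy.tensorPow_comp k).integrable_iff.2 hX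
  have hi : IndepFun (fun ω => tensorPow k (X ω)) (fun ω => tensorPow k (X' ω)) P :=
    hindep.comp (continuous_tensorPow k).measurable (continuous_tensorPow k).measurable
  have h1 : Integrable (fun ω => innerSL ℝ (tensorPow k (X ω)) (tensorPow k (X' ω))) P :=
    hi.integrable_bilin hX hX' (innerSL ℝ)
  have h2 : ∫ ω, innerSL ℝ (tensorPow k (X ω)) (tensorPow k (X' ω)) ∂P =
      innerSL ℝ (∫ ω, tensorPow k (X ω) ∂P) (∫ ω, tensorPow k (X' ω) ∂P) :=
    hi.integral_bilin hX hX' (innerSL ℝ)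
  simp only [innerSL_apply_apply, inner_tensorPow] at h1 h2
  refine ⟨h1, h2.trans ?_⟩
  rw [(hcopy.tensorPow_comp k).integral_eq, real_inner_self_eq_norm_sq, momentTensor]

/-- The moments of the marginals of a rotationally invariant vector depend on the direction
only through its norm. -/
lemma IsRotationallyInvariant.exists_integral_inner_pow_eq
    (hY : IsRotationallyInvariant Y P') (hk : 0 < k) :
    ∃ c : ℝ, ∀ x, ∫ ω, ⟪x, Y ω⟫ ^ k ∂P' = ‖x‖ ^ k * c := by
  have hrot : ∀ x y : EuclideanSpace ℝ (Fin n), ‖x‖ = ‖y‖ →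
      ∫ ω, ⟪x, Y ω⟫ ^ k ∂P' = ∫ ω, ⟪y, Y ω⟫ ^ k ∂P' := by
    intro x y hxy
    -- The reflection in the hyperplane orthogonal to x - y swaps two vectors of equal norm.
    set Q := (Submodule.span ℝ {x - y})ᗮ.reflection
    have hQ : Q x = y := Submodule.reflection_sub hxy
    have h := ((hY Q).comp (u := fun z => ⟪y, z⟫ ^ k) (by fun_prop)).integral_eq
    simp only [Function.comp_def] at h
    rw [← h, ← hQ]
    simp_rw [LinearIsometryEquiv.inner_map_map]
  rcases subsingleton_or_nontrivial (EuclideanSpace ℝ (Fin n)) with hs | hs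
  · refine ⟨0, fun x => ?_⟩
    simp [Subsingleton.elim x 0, hk.ne']
  · obtain ⟨u, hu⟩ := exists_norm_eq (EuclideanSpace ℝ (Fin n)) zero_le_one
    refine ⟨∫ ω, ⟪u, Y ω⟫ ^ k ∂P', fun x => ?_⟩
    rw [hrot x (‖x‖ • u) (by simp [norm_smul, hu])]
    simp_rw [real_inner_smul_left, mul_pow]
    exact integral_const_mul _ _

/-- The inner product moves inside the expectation over X, where it becomes E⟨x, Y⟩^k at x = X ω. -/
lemma inner_momentTensor_momentTensor (hX : Integrable (fun ω => tensorPow k (X ω)) P)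
    (hY : Integrable (fun ω => tensorPow k (Y ω)) P') {c : ℝ}
    (hc : ∀ x, ∫ ω, ⟪x, Y ω⟫ ^ k ∂P' = ‖x‖ ^ k * c) :
    ⟪momentTensor k X P, momentTensor k Y P'⟫ = (∫ ω, ‖X ω‖ ^ k ∂P) * c := by
  rw [real_inner_comm, momentTensor.eq_1 k X, ← integral_inner hX, ← integral_mul_const]
  refine integral_congr_ae (Filter.Eventually.of_forall fun ω => ?_)
  simp only
  rw [real_inner_comm, inner_momentTensor hY, hc]

namespace IsRotationalSymmetrization

lemma aemeasurable (h : IsRotationalSymmetrization Y P' X P) : AEMeasurable Y P' :=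
  (h.invariant (LinearIsometryEquiv.refl ℝ _)).aemeasurable_snd

lemma hasFiniteMoment (h : IsRotationalSymmetrization Y P' X P) (hX : HasFiniteMoment k X P) :
    HasFiniteMoment k Y P' :=
  (h.radial.comp (u := fun r => r ^ k) (by fun_prop)).integrable_iff.2 hX

lemma inner_momentTensor_eq (h : IsRotationalSymmetrization Y P' X P) (hX : AEMeasurable X P)
    (hk : 0 < k) (hm : HasFiniteMoment k X P) :
    ⟪momentTensor k X P, momentTensor k Y P'⟫ = ⟪momentTensor k Y P', momentTensor k Y P'⟫ := by
  have hXi := hm.integrable_tensorPow hX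
  have hYi := (h.hasFiniteMoment hm).integrable_tensorPow h.aemeasurable
  obtain ⟨c, hc⟩ := h.invariant.exists_integral_inner_pow_eq hk
  rw [inner_momentTensor_momentTensor hXi hYi hc, inner_momentTensor_momentTensor hYi hYi hc]
  congr 1
  exact (h.radial.comp (u := fun r => r ^ k) (by fun_prop)).integral_eq.symm

lemma inner_eccentricityTensor (h : IsRotationalSymmetrization Y P' X P) (hX : AEMeasurable X P)
    (hk : 0 < k) (hm : HasFiniteMoment k X P) :
    ⟪eccentricityTensor k X P Y P', momentTensor k Y P'⟫ = 0 := by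
  rw [eccentricityTensor, inner_sub_left, h.inner_momentTensor_eq hX hk hm, sub_self]

lemma norm_momentTensor_sq (h : IsRotationalSymmetrization Y P' X P) (hX : AEMeasurable X P)
    (hk : 0 < k) (hm : HasFiniteMoment k X P) :
    ‖momentTensor k X P‖ ^ 2 =
      ‖momentTensor k Y P'‖ ^ 2 + ‖eccentricityTensor k X P Y P'‖ ^ 2 := by
  have h0 := h.inner_eccentricityTensor hX hk hm
  have hadd : momentTensor k X P = eccentricityTensor k X P Y P' + momentTensor k Y P' := by
    simp [eccentricityTensor]
  rw [hadd, norm_add_sq_real, h0]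
  ring

end IsRotationalSymmetrization

end Moments

/-! ### Exponential moments and determinacy of the law by its moments -/

section Subexponential

variable {n : ℕ} {Ω Ω' : Type*} [MeasurableSpace Ω] [MeasurableSpace Ω']
  {P : Measure Ω} {P' : Measure Ω'}

/-- A subexponential random variable has an exponential moment. -/
lemma IsSubexponential.exists_integrable_exp [IsProbabilityMeasure P] {Z : Ω → ℝ}
    (hZ : AEMeasurable Z P) (h : IsSubexponential Z P) :
    ∃ s : ℝ, 0 < s ∧ Integrable (fun ω => Real.exp (s * |Z ω|)) P := by
  obtain ⟨K, hK, htail⟩ := h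
  have hm : AEMeasurable (fun ω => Real.exp (1 / (2 * K) * |Z ω|)) P := by fun_prop
  -- With this rate the tail bound at 2K log t becomes e · t⁻², which is integrable on (1, ∞). On
  -- (0, 1] the trivial bound 1 is used, since the tail hypothesis needs log t ≥ 0.
  refine ⟨1 / (2 * K), by positivity, hm.aestronglyMeasurable, ?_⟩
  rw [hasFiniteIntegral_iff_ofReal (Filter.Eventually.of_forall fun _ => (Real.exp_pos _).le),
    lintegral_eq_lintegral_meas_lt P (Filter.Eventually.of_forall fun _ => (Real.exp_pos _).le) hm,
    ← Set.Ioc_union_Ioi_eq_Ioi zero_le_one]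
  refine (lintegral_union_le _ _ _).trans_lt (ENNReal.add_lt_top.2 ⟨?_, ?_⟩)
  · calc _ ≤ ∫⁻ _ in Set.Ioc (0 : ℝ) 1, 1 := lintegral_mono fun _ => prob_le_one
      _ < ⊤ := by simp
  · have hint : IntegrableOn (fun t : ℝ => Real.exp 1 * t ^ (-2 : ℝ)) (Set.Ioi 1) :=
      (integrableOn_Ioi_rpow_of_lt (by norm_num) one_pos).const_mul _
    refine lt_of_le_of_lt (setLIntegral_mono_ae' measurableSet_Ioi
      (Filter.Eventually.of_forall fun t (ht : 1 < t) => ?_)) hint.lintegral_lt_top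
    have ht0 : 0 < t := one_pos.trans ht
    have hset : {ω | t < Real.exp (1 / (2 * K) * |Z ω|)} = {ω | 2 * K * Real.log t < |Z ω|} := by
      ext ω
      simp only [Set.mem_ofPred_eq]
      rw [← Real.log_lt_iff_lt_exp ht0, one_div, inv_mul_eq_div, lt_div_iff₀ (by positivity),
        mul_comm]
    rw [hset, ← ofReal_measureReal]
    refine ENNReal.ofReal_le_ofReal ((htail _ (by have := Real.log_pos ht; positivity)).trans_eq ?_)
    rw [Real.rpow_def_of_pos ht0, ← Real.exp_add]
    congr 1
    field_simp
    ring

lemma IsSubexponentialVector.exists_integrable_exp_norm [IsProbabilityMeasure P]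
    {X : Ω → EuclideanSpace ℝ (Fin n)} (hX : AEMeasurable X P) (h : IsSubexponentialVector X P) :
    ∃ s : ℝ, 0 < s ∧ Integrable (fun ω => Real.exp (s * ‖X ω‖)) P := by
  have hc : ∀ i : Fin n, ∃ s : ℝ, 0 < s ∧ Integrable (fun ω => Real.exp (s * |X ω i|)) P := by
    intro i
    have := (h (EuclideanSpace.single i 1)).exists_integrable_exp (by fun_prop)
    simpa [EuclideanSpace.inner_single_right] using this
  choose s hs hsi using hc
  -- The factor n pays for ‖X‖ ≤ n · maxⱼ |Xⱼ|.
  obtain ⟨r, hr, hrs⟩ : ∃ r : ℝ, 0 < r ∧ ∀ i, r * n ≤ s i := by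
    rcases isEmpty_or_nonempty (Fin n) with he | he
    · exact ⟨1, one_pos, fun i => he.elim i⟩
    · have hn : (0 : ℝ) < n := by
        have := Fin.pos_iff_nonempty.2 he
        exact_mod_cast this
      refine ⟨Finset.univ.inf' Finset.univ_nonempty s / n, div_pos ?_ hn, fun i => ?_⟩
      · rw [Finset.lt_inf'_iff]
        exact fun i _ => hs i
      · rw [div_mul_cancel₀ _ hn.ne']
        exact Finset.inf'_le _ (Finset.mem_univ i)
  refine ⟨r, hr, Integrable.mono' (g := fun ω => 1 + ∑ i, Real.exp (s i * |X ω i|))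
    ((integrable_const _).add (integrable_finsetSum _ fun i _ => hsi i))
    (by fun_prop) (Filter.Eventually.of_forall fun ω => ?_)⟩
  rw [Real.norm_eq_abs, abs_of_pos (Real.exp_pos _)]
  have hsum : (0 : ℝ) ≤ ∑ i, Real.exp (s i * |X ω i|) :=
    Finset.sum_nonneg fun i _ => (Real.exp_pos _).le
  have hnorm : ‖X ω‖ ≤ ∑ i, |X ω i| := by
    rw [EuclideanSpace.norm_eq]
    refine Real.sqrt_le_iff.2 ⟨Finset.sum_nonneg fun i _ => abs_nonneg _, ?_⟩
    exact Finset.sum_sq_le_sq_sum_of_nonneg fun i _ => abs_nonneg _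
  rcases isEmpty_or_nonempty (Fin n) with he | he
  · have : ‖X ω‖ ≤ 0 := by simpa using hnorm
    have : Real.exp (r * ‖X ω‖) ≤ 1 :=
      Real.exp_le_one_iff.2 (mul_nonpos_of_nonneg_of_nonpos hr.le this)
    linarith
  · obtain ⟨j, -, hj⟩ := Finset.exists_max_image Finset.univ (fun i => |X ω i|)
      Finset.univ_nonempty
    have h1 : ‖X ω‖ ≤ n * |X ω j| := by
      refine hnorm.trans ((Finset.sum_le_card_nsmul _ _ _ hj).trans_eq ?_)
      simp
    calc Real.exp (r * ‖X ω‖) ≤ Real.exp (s j * |X ω j|) := by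
          refine Real.exp_le_exp.2 ?_
          calc r * ‖X ω‖ ≤ r * (n * |X ω j|) := by gcongr
            _ = r * n * |X ω j| := by ring
            _ ≤ s j * |X ω j| := by gcongr; exact hrs j
      _ ≤ ∑ i, Real.exp (s i * |X ω i|) :=
          Finset.single_le_sum (f := fun i => Real.exp (s i * |X ω i|))
            (fun i _ => (Real.exp_pos _).le) (Finset.mem_univ j)
      _ ≤ _ := by linarith

lemma hasFiniteMoment_of_integrable_exp_norm [IsFiniteMeasure P]
    {X : Ω → EuclideanSpace ℝ (Fin n)} (hX : AEMeasurable X P) {s : ℝ} (hs : 0 < s)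
    (h : Integrable (fun ω => Real.exp (s * ‖X ω‖)) P) (k : ℕ) : HasFiniteMoment k X P := by
  refine integrable_pow_of_integrable_exp_mul hs.ne' h (Integrable.mono' (integrable_const 1)
    (by fun_prop) (Filter.Eventually.of_forall fun ω => ?_)) k
  rw [Real.norm_eq_abs, abs_of_pos (Real.exp_pos _), Real.exp_le_one_iff, neg_mul]
  exact neg_nonpos.2 (by positivity)

lemma zero_mem_interior_integrableExpSet_inner
    {X : Ω → EuclideanSpace ℝ (Fin n)} (hX : AEMeasurable X P) {s : ℝ} (hs : 0 < s)
    (h : Integrable (fun ω => Real.exp (s * ‖X ω‖)) P) (v : EuclideanSpace ℝ (Fin n)) :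
    0 ∈ interior (integrableExpSet (fun ω => ⟪v, X ω⟫) P) := by
  rw [mem_interior_iff_mem_nhds, Metric.mem_nhds_iff]
  -- Adding 1 keeps the denominator positive when v = 0.
  refine ⟨s / (‖v‖ + 1), by positivity, fun t ht => ?_⟩
  rw [mem_ball_zero_iff, Real.norm_eq_abs, lt_div_iff₀ (by positivity)] at ht
  refine Integrable.mono' h (by fun_prop) (Filter.Eventually.of_forall fun ω => ?_)
  rw [Real.norm_eq_abs, abs_of_pos (Real.exp_pos _), Real.exp_le_exp]
  calc t * ⟪v, X ω⟫ ≤ |t| * (‖v‖ * ‖X ω‖) := by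
        refine (le_abs_self _).trans ?_
        rw [abs_mul]
        gcongr
        exact abs_real_inner_le_norm _ _
    _ = |t| * ‖v‖ * ‖X ω‖ := by ring
    _ ≤ s * ‖X ω‖ := by
        gcongr
        nlinarith [abs_nonneg t]

/-- The moments of a random variable with exponential moments determine its complex
moment-generating function on the common strip of convergence. -/
lemma eqOn_complexMGF_of_integral_pow_eq {Z : Ω → ℝ} {W : Ω' → ℝ}
    (hZ : 0 ∈ interior (integrableExpSet Z P)) (hW : 0 ∈ interior (integrableExpSet W P'))
    (h : ∀ k : ℕ, ∫ ω, Z ω ^ k ∂P = ∫ ω, W ω ^ k ∂P') :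
    Set.EqOn (complexMGF Z P) (complexMGF W P')
      {z | z.re ∈ interior (integrableExpSet Z P) ∩ interior (integrableExpSet W P')} := by
  set U : Set ℂ := {z | z.re ∈ interior (integrableExpSet Z P) ∩ interior (integrableExpSet W P')}
  have hUo : IsOpen U := (isOpen_interior.inter isOpen_interior).preimage Complex.continuous_re
  have hUc : Convex ℝ U :=
    (convex_integrableExpSet.interior.inter convex_integrableExpSet.interior).linear_preimage
      Complex.reLm
  have h0 : (0 : ℂ) ∈ U := ⟨hZ, hW⟩
  have hfd : DifferentiableOn ℂ (complexMGF Z P) U :=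
    differentiableOn_complexMGF.mono fun z hz => hz.1
  have hgd : DifferentiableOn ℂ (complexMGF W P') U :=
    differentiableOn_complexMGF.mono fun z hz => hz.2
  refine (hfd.analyticOnNhd hUo).eqOn_of_preconnected_of_eventuallyEq (hgd.analyticOnNhd hUo)
    hUc.isPreconnected h0 ?_
  obtain ⟨r, hr, hball⟩ := Metric.isOpen_iff.1 hUo 0 h0
  filter_upwards [Metric.ball_mem_nhds (0 : ℂ) hr] with z hz
  -- Near 0 both functions equal their Taylor series, whose derivatives at 0 are the moments.
  rw [← Complex.taylorSeries_eq_on_ball (hfd.mono hball) hz,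
    ← Complex.taylorSeries_eq_on_ball (hgd.mono hball) hz]
  have hd : ∀ k, iteratedDeriv k (complexMGF Z P) 0 = iteratedDeriv k (complexMGF W P') 0 := by
    intro k
    rw [iteratedDeriv_complexMGF (by simpa using hZ), iteratedDeriv_complexMGF (by simpa using hW)]
    simp only [zero_mul, Complex.exp_zero, mul_one]
    exact_mod_cast congrArg (fun x : ℝ => (x : ℂ)) (h k)
  simp_rw [hd]

/-- Pairing the moment tensors with v^{⊗k} recovers all moments of the marginal along v, which
reduces the claim to dimension one. -/
lemma map_eq_of_momentTensor_eq [IsFiniteMeasure P] [IsFiniteMeasure P']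
    {X : Ω → EuclideanSpace ℝ (Fin n)} {Y : Ω' → EuclideanSpace ℝ (Fin n)}
    (hX : AEMeasurable X P) (hY : AEMeasurable Y P') {s : ℝ} (hs : 0 < s)
    (hXs : Integrable (fun ω => Real.exp (s * ‖X ω‖)) P)
    (hYs : Integrable (fun ω => Real.exp (s * ‖Y ω‖)) P')
    (h : ∀ k, momentTensor k X P = momentTensor k Y P') : P.map X = P'.map Y := by
  refine Measure.ext_of_charFun (funext fun v => ?_)
  have hZ := zero_mem_interior_integrableExpSet_inner hX hs hXs v
  have hW := zero_mem_interior_integrableExpSet_inner hY hs hYs v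
  have hmom : ∀ k : ℕ, ∫ ω, ⟪v, X ω⟫ ^ k ∂P = ∫ ω, ⟪v, Y ω⟫ ^ k ∂P' := by
    intro k
    rw [← inner_momentTensor
        ((hasFiniteMoment_of_integrable_exp_norm hX hs hXs k).integrable_tensorPow hX),
      ← inner_momentTensor
        ((hasFiniteMoment_of_integrable_exp_norm hY hs hYs k).integrable_tensorPow hY), h k]
  have hI := eqOn_complexMGF_of_integral_pow_eq hZ hW hmom
    (x := Complex.I) (by simpa using ⟨hZ, hW⟩)
  rw [charFun_apply, charFun_apply, integral_map hX (by fun_prop), integral_map hY (by fun_prop)]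
  simpa only [complexMGF, mul_comm Complex.I, real_inner_comm v] using hI

end Subexponential

theorem mainTheorem1 {n : ℕ} {Ω Ω' : Type*} [MeasurableSpace Ω] [MeasurableSpace Ω']
    (P : Measure Ω) [IsProbabilityMeasure P] (P' : Measure Ω') [IsProbabilityMeasure P']
    -- a random vector and an independent copy of it
    (X X' : Ω → EuclideanSpace ℝ (Fin n)) (hX : AEMeasurable X P)
    (hcopy : IdentDistrib X' X P P) (hindep : IndepFun X X' P)
    -- two independent copies of the rotational symmetrization
    (Xrot Xrot' : Ω' → EuclideanSpace ℝ (Fin n))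
    (hrot : IsRotationalSymmetrization Xrot P' X P)
    (hcopy_rot : IdentDistrib Xrot' Xrot P' P') (hindep_rot : IndepFun Xrot Xrot' P') :
    -- minimization
    (∀ k : ℕ, 0 < k → HasFiniteMoment k X P →
      Integrable (fun ω => ⟪X ω, X' ω⟫ ^ k) P ∧
      Integrable (fun ω => ⟪Xrot ω, Xrot' ω⟫ ^ k) P' ∧
      ∫ ω, ⟪Xrot ω, Xrot' ω⟫ ^ k ∂P' ≤ ∫ ω, ⟪X ω, X' ω⟫ ^ k ∂P) ∧
    -- uniqueness
    (IsSubexponentialVector X P →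
      (∀ k : ℕ, 0 < k → ∫ ω, ⟪X ω, X' ω⟫ ^ k ∂P = ∫ ω, ⟪Xrot ω, Xrot' ω⟫ ^ k ∂P') →
      IsRotationallyInvariant X P) ∧
    -- orthogonality of the eccentricity tensors
    (∀ k : ℕ, 0 < k → HasFiniteMoment k X P →
      Integrable (fun ω => tensorPow k (X ω)) P ∧
      Integrable (fun ω => tensorPow k (Xrot ω)) P' ∧
      ⟪eccentricityTensor k X P Xrot P', momentTensor k Xrot P'⟫ = 0 ∧
      ‖momentTensor k X P‖ ^ 2 =
        ‖momentTensor k Xrot P'‖ ^ 2 + ‖eccentricityTensor k X P Xrot P'‖ ^ 2) := by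
  have hYm := hrot.aemeasurable
  have hsq : ∀ k : ℕ, HasFiniteMoment k X P →
      (Integrable (fun ω => ⟪X ω, X' ω⟫ ^ k) P ∧
        ∫ ω, ⟪X ω, X' ω⟫ ^ k ∂P = ‖momentTensor k X P‖ ^ 2) ∧
      (Integrable (fun ω => ⟪Xrot ω, Xrot' ω⟫ ^ k) P' ∧
        ∫ ω, ⟪Xrot ω, Xrot' ω⟫ ^ k ∂P' = ‖momentTensor k Xrot P'‖ ^ 2) := fun k hm =>
    ⟨integral_inner_pow_eq_norm_momentTensor_sq (hm.integrable_tensorPow hX) hcopy hindep,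
      integral_inner_pow_eq_norm_momentTensor_sq
        ((hrot.hasFiniteMoment hm).integrable_tensorPow hYm) hcopy_rot hindep_rot⟩
  refine ⟨fun k hk hm => ?_, fun hsub heq => ?_, fun k hk hm => ?_⟩
  · obtain ⟨⟨h1, h2⟩, h3, h4⟩ := hsq k hm
    refine ⟨h1, h3, ?_⟩
    rw [h2, h4, hrot.norm_momentTensor_sq hX hk hm]
    exact le_add_of_nonneg_right (sq_nonneg _)
  · obtain ⟨s, hs, hXs⟩ := hsub.exists_integrable_exp_norm hX
    have hYs : Integrable (fun ω => Real.exp (s * ‖Xrot ω‖)) P' :=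
      (hrot.radial.comp (u := fun r => Real.exp (s * r)) (by fun_prop)).integrable_iff.2 hXs
    have hmom : ∀ k, momentTensor k X P = momentTensor k Xrot P' := by
      intro k
      rcases Nat.eq_zero_or_pos k with rfl | hk
      -- Equality is assumed only for k > 0; for k = 0 both tensors record the total mass 1.
      · simp [momentTensor, tensorPow]
      have hm := hasFiniteMoment_of_integrable_exp_norm hX hs hXs k
      obtain ⟨⟨-, h2⟩, -, h4⟩ := hsq k hm
      have h := hrot.norm_momentTensor_sq hX hk hm
      rw [← h2, ← h4, heq k hk, left_eq_add, sq_eq_zero_iff, norm_eq_zero] at h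
      exact sub_eq_zero.1 h
    have hXY : IdentDistrib X Xrot P P' :=
      ⟨hX, hYm, map_eq_of_momentTensor_eq hX hYm hs hXs hYs hmom⟩
    exact fun Q => ((hXY.comp Q.continuous.measurable).trans (hrot.invariant Q)).trans hXY.symm
  · exact ⟨hm.integrable_tensorPow hX, (hrot.hasFiniteMoment hm).integrable_tensorPow hYm,
      hrot.inner_eccentricityTensor hX hk hm, hrot.norm_momentTensor_sq hX hk hm⟩
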